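/- Let $(X,d_X,\mu_X)$ be an mm-space, that is, a complete separable metric space $(X,d_X)$ with a Borel probability measure $\mu_X$, and let $\alpha\in(0,1)$. For a Borel probability measure $\mu$ on a metric space $Z$ put $$\operatorname{diam}(\mu;\alpha):=\inf\{\operatorname{diam}A \mid A\subset Z \text{ Borel},\ \mu(A)\ge\alpha\}\in[0,\infty],$$ and define the $\alpha$-partial diameter and the $\alpha$-observable diameter of $X$ by $$\operatorname{diam}(X;\alpha):=\operatorname{diam}(\mu_X;\alpha),\qquad \operatorname{Obsdiam}(X;\alpha):=\sup\{\operatorname{diam}(f_*\mu_X;\alpha)\mid f:X\to\mathbb{R}\ \text{is 1-Lipschitz}\},$$ where $f_*\mu_X$ is the push-forward of $\mu_X$ by $f$, a measure on $\mathbb{R}$ with its usual metric. Then the following are equivalent. 1. There exists a point $x\in X$ such that $\mu_X(\{x\})\ge\alpha$. 2. $\operatorname{diam}(X;\alpha)=0$. 3. $\operatorname{Obsdiam}(X;\alpha)=0$. -/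

import Mathlib

open MeasureTheory
open scoped ENNReal

/-- The `α`-partial diameter `diam(μ; α)` of a Borel measure `μ` on a metric space: the infimum, in
`[0, ∞]`, of the diameters of the Borel sets of measure at least `α`. -/
noncomputable def partialDiam {X : Type*} [MetricSpace X] [MeasurableSpace X]
    (μ : Measure X) (α : ℝ) : ℝ≥0∞ :=
  sInf {d : ℝ≥0∞ | ∃ A : Set X, MeasurableSet A ∧ ENNReal.ofReal α ≤ μ A ∧ d = Metric.ediam A}

/-- The `α`-observable diameter `Obsdiam(X; α)` of the metric measure space `(X, d, μ)`: the
supremum, in `[0, ∞]`, of the `α`-partial diameters of the push-forwards of `μ` under the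
`1`-Lipschitz functions `X → ℝ`. -/
noncomputable def obsDiam {X : Type*} [MetricSpace X] [MeasurableSpace X]
    (μ : Measure X) (α : ℝ) : ℝ≥0∞ :=
  sSup {d : ℝ≥0∞ | ∃ f : X → ℝ, LipschitzWith 1 f ∧ d = partialDiam (μ.map f) α}

/-
A sequence of sets of measure at least `a > 0` in a finite measure space has a limsup of measure at
least `a`, so some `x` lies in infinitely many of them. If moreover no two distinct points lie
together in infinitely many of them, then those members that contain `x` have limsup `{x}`, and
`a ≤ μ {x}` follows. This shrinking argument is applied twice:

* to sets whose diameters tend to `0`, which gives (2) → (1), and also an atom of mass at least `α`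
  for every push-forward of `μ` under a `1`-Lipschitz function when `Obsdiam(X; α) = 0`;
* to the level sets carrying these atoms, for a sequence of `1`-Lipschitz functions that separates
  any two points from some index on, which gives (3) → (1).

For such a sequence, embed `X` in `ℓ^∞` and take the Abel means `(1 - s) ∑ uₙ sⁿ` with `s ↓ 0`: they
are `1`-Lipschitz in `u`, and a nonzero power series does not vanish at small `s ≠ 0`.
-/

open Filter Set Topology
open scoped lp

section Shrinking

variable {X : Type*} [MeasurableSpace X] {μ : Measure X} [IsFiniteMeasure μ] {a : ℝ≥0∞}
  {s : ℕ → Set X}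

theorem le_measure_limsup_of_frequently_le (hs : ∀ n, NullMeasurableSet (s n) μ)
    (h : ∃ᶠ n in atTop, a ≤ μ (s n)) : a ≤ μ (limsup s atTop) := by
  have hanti : Antitone fun n ↦ ⋃ k ≥ n, s k := fun m n hmn ↦
    biUnion_subset_biUnion_left fun k (hk : n ≤ k) ↦ hmn.trans hk
  have hlimsup : limsup s atTop = ⋂ n, ⋃ k ≥ n, s k := limsup_eq_iInf_iSup_of_nat
  rw [hlimsup, hanti.measure_iInter
    (fun n ↦ .biUnion (to_countable _) fun k _ ↦ hs k) ⟨0, measure_ne_top μ _⟩]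
  refine le_iInf fun n ↦ ?_
  obtain ⟨k, hnk, hk⟩ := frequently_atTop.1 h n
  exact hk.trans (measure_mono (subset_biUnion_of_mem hnk))

theorem exists_le_measure_singleton_of_eventually_not_both_mem
    (hs : ∀ n, NullMeasurableSet (s n) μ) (ha : a ≠ 0) (h : ∀ n, a ≤ μ (s n))
    (hsep : Pairwise fun x y ↦ ∀ᶠ n in atTop, ¬(x ∈ s n ∧ y ∈ s n)) :
    ∃ x, a ≤ μ {x} := by
  have hpos : μ (limsup s atTop) ≠ 0 := fun h₀ ↦
    ha (nonpos_iff_eq_zero.1 (h₀ ▸ le_measure_limsup_of_frequently_le hs (.of_forall h)))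
  obtain ⟨x, hx⟩ := nonempty_of_measure_ne_zero hpos
  replace hx : ∃ᶠ n in atTop, x ∈ s n := mem_limsup_iff_frequently_mem.1 hx
  let t n := {y | x ∈ s n ∧ y ∈ s n}
  have ht : ∀ n, NullMeasurableSet (t n) μ := fun n ↦ .inter (.const _) (hs n)
  have hta : ∃ᶠ n in atTop, a ≤ μ (t n) := hx.mono fun n hn ↦
    (h n).trans (measure_mono fun _ hy ↦ ⟨hn, hy⟩)
  have htx : limsup t atTop ⊆ {x} := fun y hy ↦ by
    by_contra hyx
    exact mem_limsup_iff_frequently_mem.1 hy (hsep (Ne.symm hyx))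
  exact ⟨x, (le_measure_limsup_of_frequently_le ht hta).trans (measure_mono htx)⟩

end Shrinking

section PartialDiam

variable {X Y : Type*} [MetricSpace X] [MeasurableSpace X] [MetricSpace Y] [MeasurableSpace Y]
  {μ : Measure X} {α : ℝ}

theorem partialDiam_le_ediam {A : Set X} (hA : MeasurableSet A) (hα : ENNReal.ofReal α ≤ μ A) :
    partialDiam μ α ≤ Metric.ediam A :=
  sInf_le ⟨A, hA, hα, rfl⟩

theorem exists_measurableSet_ediam_lt {ε : ℝ≥0∞} (h : partialDiam μ α < ε) :
    ∃ A, MeasurableSet A ∧ ENNReal.ofReal α ≤ μ A ∧ Metric.ediam A < ε := by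
  obtain ⟨_, ⟨A, hA, hαA, rfl⟩, hlt⟩ := sInf_lt_iff.1 h
  exact ⟨A, hA, hαA, hlt⟩

theorem partialDiam_map_le [OpensMeasurableSpace X] [BorelSpace Y] {f : X → Y}
    (hf : LipschitzWith 1 f) : partialDiam (μ.map f) α ≤ partialDiam μ α := by
  refine le_sInf ?_
  rintro _ ⟨A, -, hαA, rfl⟩
  -- The image of a Borel set need not be Borel; its closure is, and has the same diameter.
  have hmeas : MeasurableSet (closure (f '' A)) := isClosed_closure.measurableSet
  have hα : ENNReal.ofReal α ≤ μ.map f (closure (f '' A)) := by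
    rw [Measure.map_apply hf.continuous.measurable hmeas]
    exact hαA.trans (measure_mono (image_subset_iff.1 subset_closure))
  calc partialDiam (μ.map f) α ≤ Metric.ediam (closure (f '' A)) := partialDiam_le_ediam hmeas hα
    _ = Metric.ediam (f '' A) := Metric.ediam_closure _
    _ ≤ Metric.ediam A := by simpa using hf.ediam_image_le A

theorem exists_le_measure_singleton_of_partialDiam_eq_zero [IsFiniteMeasure μ] (hα : 0 < α)
    (h : partialDiam μ α = 0) : ∃ x, ENNReal.ofReal α ≤ μ {x} := by
  have hA (n : ℕ) : ∃ A, MeasurableSet A ∧ ENNReal.ofReal α ≤ μ A ∧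
      Metric.ediam A < (n : ℝ≥0∞)⁻¹ :=
    exists_measurableSet_ediam_lt (h ▸ ENNReal.inv_pos.2 (ENNReal.natCast_ne_top n))
  choose A hmeas hαA hdiam using hA
  refine exists_le_measure_singleton_of_eventually_not_both_mem
    (fun n ↦ (hmeas n).nullMeasurableSet) (ENNReal.ofReal_pos.2 hα).ne' hαA fun x y hxy ↦ ?_
  filter_upwards [ENNReal.tendsto_inv_nat_nhds_zero.eventually_lt_const (edist_pos.2 hxy)]
    with n hn ⟨hx, hy⟩
  exact (hn.trans_le (Metric.edist_le_ediam_of_mem hx hy)).not_gt (hdiam n)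

theorem partialDiam_eq_zero_iff [MeasurableSingletonClass X] [IsFiniteMeasure μ] (hα : 0 < α) :
    partialDiam μ α = 0 ↔ ∃ x, ENNReal.ofReal α ≤ μ {x} := by
  refine ⟨exists_le_measure_singleton_of_partialDiam_eq_zero hα, fun ⟨x, hx⟩ ↦ ?_⟩
  simpa using partialDiam_le_ediam (measurableSet_singleton x) hx

theorem partialDiam_map_le_obsDiam {f : X → ℝ} (hf : LipschitzWith 1 f) :
    partialDiam (μ.map f) α ≤ obsDiam μ α :=
  le_sSup ⟨f, hf, rfl⟩

theorem obsDiam_le_partialDiam [OpensMeasurableSpace X] : obsDiam μ α ≤ partialDiam μ α := by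
  refine sSup_le ?_
  rintro _ ⟨f, hf, rfl⟩
  exact partialDiam_map_le hf

end PartialDiam

section AbelMean

/-- The Abel mean `(1 - s) ∑ uₙ sⁿ` of a bounded sequence `u`, a weighted average of its terms for
`0 ≤ s < 1`. Its one-parameter family of functionals on `ℓ^∞` is used to separate points. For
`1 ≤ |s|` the series may diverge, and then the value is `0`. -/
noncomputable def abelMean (s : ℝ) (u : ℓ^∞(ℕ, ℝ)) : ℝ :=
  (1 - s) * ∑' n, u n * s ^ n

variable {s : ℝ}

theorem norm_abelMean_term_le (hs : 0 ≤ s) (u : ℓ^∞(ℕ, ℝ)) (n : ℕ) :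
    ‖u n * s ^ n‖ ≤ ‖u‖ * s ^ n := by
  rw [norm_mul, Real.norm_of_nonneg (pow_nonneg hs n)]
  gcongr
  exact lp.norm_apply_le_norm ENNReal.top_ne_zero u n

theorem summable_abelMean_term (hs : s ∈ Ico (0 : ℝ) 1) (u : ℓ^∞(ℕ, ℝ)) :
    Summable fun n ↦ u n * s ^ n :=
  .of_norm_bounded ((summable_geometric_of_lt_one hs.1 hs.2).mul_left ‖u‖)
    (norm_abelMean_term_le hs.1 u)

theorem abelMean_sub (hs : s ∈ Ico (0 : ℝ) 1) (u v : ℓ^∞(ℕ, ℝ)) :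
    abelMean s (u - v) = abelMean s u - abelMean s v := by
  simp only [abelMean, lp.coeFn_sub, Pi.sub_apply, sub_mul (u _),
    (summable_abelMean_term hs u).tsum_sub (summable_abelMean_term hs v), mul_sub]

theorem norm_abelMean_le (hs : s ∈ Ico (0 : ℝ) 1) (u : ℓ^∞(ℕ, ℝ)) : ‖abelMean s u‖ ≤ ‖u‖ := by
  have hpos : 0 < 1 - s := sub_pos.2 hs.2
  calc ‖abelMean s u‖ = (1 - s) * ‖∑' n, u n * s ^ n‖ := by
        rw [abelMean, norm_mul, Real.norm_of_nonneg hpos.le]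
    _ ≤ (1 - s) * (‖u‖ * (1 - s)⁻¹) := by
        gcongr
        exact tsum_of_norm_bounded ((hasSum_geometric_of_lt_one hs.1 hs.2).mul_left ‖u‖)
          (norm_abelMean_term_le hs.1 u)
    _ = ‖u‖ := by field_simp

theorem lipschitzWith_one_abelMean (hs : s ∈ Ico (0 : ℝ) 1) : LipschitzWith 1 (abelMean s) :=
  .of_dist_le_mul fun u v ↦ by
    simpa [dist_eq_norm, abelMean_sub hs] using norm_abelMean_le hs (u - v)

theorem eventually_abelMean_ne_zero {u : ℓ^∞(ℕ, ℝ)} (hu : u ≠ 0) :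
    ∀ᶠ s in 𝓝[≠] 0, abelMean s u ≠ 0 := by
  let p := FormalMultilinearSeries.ofScalars ℝ (u : ℕ → ℝ)
  have hp : p ≠ 0 := fun hp₀ ↦
    hu (lp.ext ((FormalMultilinearSeries.ofScalars_series_eq_zero (E := ℝ)).1 hp₀))
  have hradius : 1 ≤ p.radius := p.le_radius_of_bound ‖u‖ (r := 1) fun n ↦ by
    simpa [p, FormalMultilinearSeries.ofScalars_norm]
      using lp.norm_apply_le_norm ENNReal.top_ne_zero u n
  have hseries := (p.hasFPowerSeriesOnBall (one_pos.trans_le hradius)).hasFPowerSeriesAt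
  filter_upwards [hseries.locally_ne_zero hp,
    nhdsWithin_le_nhds (eventually_ne_nhds zero_ne_one)] with s hs hs1
  have hsum : p.sum s = ∑' n, u n * s ^ n := FormalMultilinearSeries.ofScalars_sum_eq _ s
  exact mul_ne_zero (sub_ne_zero.2 hs1.symm) (hsum ▸ hs)

end AbelMean

theorem exists_seq_lipschitzWith_one_eventually_ne (X : Type*) [MetricSpace X]
    [TopologicalSpace.SeparableSpace X] :
    ∃ f : ℕ → X → ℝ, (∀ n, LipschitzWith 1 (f n)) ∧
      Pairwise fun x y ↦ ∀ᶠ n in atTop, f n x ≠ f n y := by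
  have hι : Isometry (kuratowskiEmbedding X) := kuratowskiEmbedding.isometry X
  obtain ⟨s, -, hs, hs₀⟩ := exists_seq_strictAnti_tendsto' (zero_lt_one' ℝ)
  have hsIco (n : ℕ) : s n ∈ Ico (0 : ℝ) 1 := Ioo_subset_Ico_self (hs n)
  refine ⟨fun n ↦ abelMean (s n) ∘ kuratowskiEmbedding X, fun n ↦ ?_, fun x y hxy ↦ ?_⟩
  · simpa using (lipschitzWith_one_abelMean (hsIco n)).comp hι.lipschitz
  · have hs_ne : Tendsto s atTop (𝓝[≠] 0) :=
      tendsto_nhdsWithin_iff.2 ⟨hs₀, .of_forall fun n ↦ (hs n).1.ne'⟩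
    filter_upwards [hs_ne.eventually (eventually_abelMean_ne_zero
      (sub_ne_zero.2 (hι.injective.ne hxy)))] with n hn
    rwa [abelMean_sub (hsIco n), sub_ne_zero] at hn

theorem exists_le_measure_singleton_of_obsDiam_eq_zero {X : Type*} [MetricSpace X]
    [TopologicalSpace.SeparableSpace X] [MeasurableSpace X] [OpensMeasurableSpace X]
    {μ : Measure X} [IsFiniteMeasure μ] {α : ℝ} (hα : 0 < α) (h : obsDiam μ α = 0) :
    ∃ x, ENNReal.ofReal α ≤ μ {x} := by
  obtain ⟨f, hf, hsep⟩ := exists_seq_lipschitzWith_one_eventually_ne X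
  have hatom (n : ℕ) : ∃ t, ENNReal.ofReal α ≤ μ.map (f n) {t} :=
    exists_le_measure_singleton_of_partialDiam_eq_zero hα
      (nonpos_iff_eq_zero.1 (h ▸ partialDiam_map_le_obsDiam (hf n)))
  choose t ht using hatom
  have hmeas (n : ℕ) : Measurable (f n) := (hf n).continuous.measurable
  refine exists_le_measure_singleton_of_eventually_not_both_mem (s := fun n ↦ f n ⁻¹' {t n})
    (fun n ↦ (hmeas n (measurableSet_singleton _)).nullMeasurableSet)
    (ENNReal.ofReal_pos.2 hα).ne' (fun n ↦ ?_) fun x y hxy ↦ ?_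
  · simpa only [Measure.map_apply (hmeas n) (measurableSet_singleton _)] using ht n
  · filter_upwards [hsep hxy] with n hn ⟨hx, hy⟩
    exact hn (hx.trans hy.symm)

theorem theorem1_general {X : Type*} [MetricSpace X] [TopologicalSpace.SeparableSpace X]
    [MeasurableSpace X] [OpensMeasurableSpace X] (μ : Measure X) [IsFiniteMeasure μ] {α : ℝ}
    (hα : 0 < α) :
    List.TFAE [
      ∃ x : X, ENNReal.ofReal α ≤ μ {x},
      partialDiam μ α = 0,
      obsDiam μ α = 0] := by
  tfae_have 1 ↔ 2 := (partialDiam_eq_zero_iff hα).symm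
  tfae_have 2 → 3 := fun h ↦ nonpos_iff_eq_zero.1 (h ▸ obsDiam_le_partialDiam)
  tfae_have 3 → 1 := exists_le_measure_singleton_of_obsDiam_eq_zero hα
  tfae_finish

theorem theorem1 {X : Type*} [MetricSpace X] [CompleteSpace X]
    [TopologicalSpace.SeparableSpace X] [MeasurableSpace X] [BorelSpace X]
    (μ : Measure X) [IsProbabilityMeasure μ] (α : ℝ) (hα : α ∈ Set.Ioo (0 : ℝ) 1) :
    List.TFAE [
      ∃ x : X, ENNReal.ofReal α ≤ μ {x},
      partialDiam μ α = 0,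
      obsDiam μ α = 0] :=
  theorem1_general μ hα.1
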